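/- Let $\Gamma$ be a game with $N$ players in which player $i$ chooses a point $x_i=(x_i^1,\dots,x_i^{n_i+1})$ of the simplex $\Delta_i=\{x_i\in\mathbb R_+^{n_i+1}:\sum_{j=1}^{n_i+1}x_i^j=1\}$ and has utility $$f_i(x)=\sum_{k\neq i}x_i^{T}Q_{ik}x_k+\sum_{j=1}^N r_j^{T}x_j,\qquad Q_{ik}=(q_{ik}^{jl})\in\mathbb R^{(n_i+1)\times(n_k+1)},\quad r_j\in\mathbb R^{n_j+1}.$$ For $\tau>0$ let $f_i^\tau(x)=f_i(x)-\tau\sum_{j=1}^{n_i+1}x_i^j\ln x_i^j$ (with $0\ln 0=0$). Let $\Gamma^{\tau,t}$ be the game obtained by eliminating the last coordinates through $x_i^{n_i+1}=1-\sum_{j=1}^{n_i}x_i^j$: its action sets are $\Delta_i^t=\{x_i\in\mathbb R_+^{n_i}:\sum_{j=1}^{n_i}x_i^j\le 1\}$, and its utilities $f_i^{\tau,t}$ are the functions $f_i^\tau$ after this substitution. A point $x\in\prod_i\Delta_i^t$ is a Nash equilibrium of $\Gamma^{\tau,t}$ if $f_i^{\tau,t}(x_i,x_{-i})\ge f_i^{\tau,t}(z,x_{-i})$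 for all $i$ and all $z\in\Delta_i^t$. Put $m=\max_i n_i$, and let $\hat\Delta^\tau$ be the set of all $x=(x_1,\dots,x_N)$, $x_i\in\mathbb R^{n_i}$, such that for every $i$ $$x_i^j\ge\frac{e^{-1/\tau^2}}{m+1}\ \ (1\le j\le n_i),\qquad \sum_{j=1}^{n_i}x_i^j\le 1-\frac{e^{-1/\tau^{1.5}}}{m+1}.$$ For $1\le i\le N$ and $1\le j\le n_i$ let $$l_{i,j}^\tau(x)=\Big(\hat r_i^j+\sum_{k\ne i}\sum_{l=1}^{n_k}\hat q_{ik}^{jl}x_k^l-\tau\ln x_i^j+\tau\ln\big(1-\sum_{\ell=1}^{n_i}x_i^\ell\big)\Big)^2,$$ where $\hat q_{ik}^{jl}=q_{ik}^{jl}-q_{ik}^{j,n_k+1}-q_{ik}^{n_i+1,l}+q_{ik}^{n_i+1,n_k+1}$ and $\hat r_i^j=r_i^j-r_i^{n_i+1}+\sum_{k\ne i}(q_{ik}^{j,n_k+1}-q_{ik}^{n_i+1,n_k+1})$, so that $l_{i,j}^\tau=(\partial f_i^{\tau,t}/\partial x_i^j)^2$ wherever all $x_i^j>0$ and $\sum_{\ell}x_i^\ell<1$.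 Let $$\mathcal S^\tau_{i,j}=\{x\in\hat\Delta^\tau:\ \langle\nabla l_{i,j}^\tau(x),y-x\rangle\ge 0\ \text{ for all }y\in\hat\Delta^\tau\},\qquad \mathcal S^\tau=\bigcap_{i=1}^N\bigcap_{j=1}^{n_i}\mathcal S^\tau_{i,j}.$$ **Lemma.** There is $\tau_0>0$, depending on the game $\Gamma$, such that for every $\tau\in(0,\tau_0)$ the set $\mathcal S^\tau$ is nonempty and equals the set of Nash equilibria of $\Gamma^{\tau,t}$. Moreover, for these $\tau$ no point of the boundary of $\hat\Delta^\tau$ belongs to $\mathcal S^\tau$. -/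

import Mathlib

/-- Data of a game `Γ` with players `i : Fin N`. The action set of player `i` is the simplex in
`ℝ^{n i + 1}`, and the utility functions are given by matrices `Q i k` (used only for `k ≠ i`)
and vectors `r j`. -/
structure SimplexGame (N : ℕ) (n : Fin N → ℕ) where
  Q : (i k : Fin N) → Matrix (Fin (n i + 1)) (Fin (n k + 1)) ℝ
  r : (j : Fin N) → Fin (n j + 1) → ℝ

namespace SimplexGame

variable {N : ℕ} {n : Fin N → ℕ}

/-- `f_i(x) = ∑_{k ≠ i} x_iᵀ Q_{ik} x_k + ∑_j r_jᵀ x_j`. -/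
noncomputable def utility (G : SimplexGame N n) (i : Fin N)
    (x : (i : Fin N) → Fin (n i + 1) → ℝ) : ℝ :=
  (∑ k ∈ Finset.univ.filter (fun k => k ≠ i), ∑ j, ∑ l, x i j * G.Q i k j l * x k l)
    + ∑ j, ∑ l, G.r j l * x j l

/-- The utility of `Γ^τ`: `f_i^τ(x) = f_i(x) - τ ∑_j x_i^j ln x_i^j` (with `0 ln 0 = 0`). -/
noncomputable def regUtility (G : SimplexGame N n) (τ : ℝ) (i : Fin N)
    (x : (i : Fin N) → Fin (n i + 1) → ℝ) : ℝ :=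
  G.utility i x - τ * ∑ j, x i j * Real.log (x i j)

/-- The substitution `x_i^{n_i+1} = 1 - ∑_{j ≤ n_i} x_i^j` for every player. -/
noncomputable def lift (x : (i : Fin N) → Fin (n i) → ℝ) :
    (i : Fin N) → Fin (n i + 1) → ℝ :=
  fun i => Fin.snoc (α := fun _ => ℝ) (x i) (1 - ∑ j, x i j)

/-- The utility `f_i^{τ,t}` of the transformed regularized game `Γ^{τ,t}`. -/
noncomputable def regUtilityT (G : SimplexGame N n) (τ : ℝ) (i : Fin N)
    (x : (i : Fin N) → Fin (n i) → ℝ) : ℝ :=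
  G.regUtility τ i (lift x)

/-- `Δ_i^t = {z ∈ ℝ^{m}_+ : ∑_j z^j ≤ 1}`, where `m = n_i`. -/
def actionSetT (m : ℕ) : Set (Fin m → ℝ) :=
  {z | (∀ j, 0 ≤ z j) ∧ ∑ j, z j ≤ 1}

/-- The set of Nash equilibria of the transformed regularized game `Γ^{τ,t}`, whose action sets
are `Δ_i^t` and whose utilities are `f_i^{τ,t}`. -/
def nashT (G : SimplexGame N n) (τ : ℝ) : Set ((i : Fin N) → Fin (n i) → ℝ) :=
  {x | (∀ i, x i ∈ actionSetT (n i)) ∧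
    ∀ i, ∀ z ∈ actionSetT (n i),
      G.regUtilityT τ i (Function.update x i z) ≤ G.regUtilityT τ i x}

/-- `max_i n_i`. -/
def maxDim (n : Fin N → ℕ) : ℕ := Finset.univ.sup n

/-- The restricted set `Δ̂^τ = ×_i Δ̂_i^τ`. -/
def hatDelta (n : Fin N → ℕ) (τ : ℝ) : Set ((i : Fin N) → Fin (n i) → ℝ) :=
  {x | ∀ i, (∀ j, Real.exp (-1 / τ ^ 2) / (maxDim n + 1 : ℝ) ≤ x i j) ∧
    ∑ j, x i j ≤ 1 - Real.exp (-1 / τ ^ (3 / 2 : ℝ)) / (maxDim n + 1 : ℝ)}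

/-- The coefficient `q̂_{ik}^{jl}` of `x_i^j x_k^l` in the transformed utility of player `i`. -/
def qHat (G : SimplexGame N n) (i k : Fin N) : Matrix (Fin (n i)) (Fin (n k)) ℝ :=
  fun j l => G.Q i k j.castSucc l.castSucc - G.Q i k j.castSucc (Fin.last _)
    - G.Q i k (Fin.last _) l.castSucc + G.Q i k (Fin.last _) (Fin.last _)

/-- The coefficient `r̂_i^j` of `x_i^j` in the transformed utility of player `i`. -/
noncomputable def rHat (G : SimplexGame N n) (i : Fin N) (j : Fin (n i)) : ℝ :=
  G.r i j.castSucc - G.r i (Fin.last _)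
    + ∑ k ∈ Finset.univ.filter (fun k => k ≠ i),
        (G.Q i k j.castSucc (Fin.last _) - G.Q i k (Fin.last _) (Fin.last _))

/-- The coefficients `qHat`, `rHat` are those of the transformed utility `f_i^t = f_i ∘ lift`: up
to terms that do not involve the action of player `i`, it is
`∑_{k ≠ i} x_iᵀ Q̂_{ik} x_k + r̂_iᵀ x_i`. -/
theorem utility_lift (G : SimplexGame N n) (i : Fin N) (x : (i : Fin N) → Fin (n i) → ℝ) :
    G.utility i (lift x) =
      (∑ k ∈ Finset.univ.filter (fun k => k ≠ i), ∑ j, ∑ l, x i j * G.qHat i k j l * x k l)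
      + ∑ j, G.rHat i j * x i j
      + ((∑ k ∈ Finset.univ.filter (fun k => k ≠ i),
          ((∑ l, (G.r k l.castSucc - G.r k (Fin.last _) + G.Q i k (Fin.last _) l.castSucc
              - G.Q i k (Fin.last _) (Fin.last _)) * x k l)
            + G.Q i k (Fin.last _) (Fin.last _)))
        + ∑ j, G.r j (Fin.last _)) := by
  have key : ∀ k, (∑ j, ∑ l, lift x i j * G.Q i k j l * lift x k l) =
      (∑ j, ∑ l, x i j * G.qHat i k j l * x k l)
      + (∑ j, (G.Q i k j.castSucc (Fin.last _) - G.Q i k (Fin.last _) (Fin.last _)) * x i j)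
      + (∑ l, (G.Q i k (Fin.last _) l.castSucc - G.Q i k (Fin.last _) (Fin.last _)) * x k l)
      + G.Q i k (Fin.last _) (Fin.last _) := by
    intro k
    have e0 : ∀ j, (∑ l, x i j * G.qHat i k j l * x k l) =
        x i j * (∑ l, G.Q i k j.castSucc l.castSucc * x k l)
        - G.Q i k j.castSucc (Fin.last _) * x i j * (∑ l, x k l)
        - x i j * (∑ l, G.Q i k (Fin.last _) l.castSucc * x k l)
        + x i j * ((∑ l, x k l) * G.Q i k (Fin.last _) (Fin.last _)) := by
      intro j
      simp only [Finset.mul_sum, Finset.sum_mul, ← Finset.sum_sub_distrib,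
        ← Finset.sum_add_distrib, qHat]
      exact Finset.sum_congr rfl fun l _ => by ring
    have e1 : ∀ j, (∑ l, lift x i j * G.Q i k j l * lift x k l) =
        lift x i j * ((∑ l, G.Q i k j l.castSucc * x k l)
          + G.Q i k j (Fin.last _) * (1 - ∑ l, x k l)) := by
      intro j
      simp only [lift, Fin.sum_univ_castSucc (n := n k), Fin.snoc_castSucc, Fin.snoc_last,
        mul_assoc, Finset.mul_sum, mul_add]
    have e2 : ∀ j : Fin (n i), x i j * ((∑ l, G.Q i k j.castSucc l.castSucc * x k l)
          + G.Q i k j.castSucc (Fin.last _) * (1 - ∑ l, x k l)) =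
        x i j * (∑ l, G.Q i k j.castSucc l.castSucc * x k l)
        + G.Q i k j.castSucc (Fin.last _) * x i j
        - G.Q i k j.castSucc (Fin.last _) * x i j * (∑ l, x k l) := fun j => by ring
    simp only [e0, e1]
    rw [Fin.sum_univ_castSucc]
    simp only [lift, Fin.snoc_castSucc, Fin.snoc_last, e2, sub_mul, Finset.sum_sub_distrib,
      Finset.sum_add_distrib, ← Finset.mul_sum, ← Finset.sum_mul]
    ring
  have lin : ∀ j, (∑ l, G.r j l * lift x j l) =
      (∑ l, (G.r j l.castSucc - G.r j (Fin.last _)) * x j l) + G.r j (Fin.last _) := by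
    intro j
    simp only [lift, Fin.sum_univ_castSucc, Fin.snoc_castSucc, Fin.snoc_last, sub_mul,
      Finset.sum_sub_distrib, ← Finset.mul_sum]
    ring
  have rh : (∑ j, G.rHat i j * x i j) =
      (∑ l, (G.r i l.castSucc - G.r i (Fin.last _)) * x i l)
      + ∑ k ∈ Finset.univ.filter (fun k => k ≠ i),
        ∑ j, (G.Q i k j.castSucc (Fin.last _) - G.Q i k (Fin.last _) (Fin.last _)) * x i j := by
    rw [Finset.sum_comm]
    simp only [rHat, add_mul, Finset.sum_add_distrib, Finset.sum_mul]
  have split : (∑ j, ∑ l, (G.r j l.castSucc - G.r j (Fin.last _)) * x j l) =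
      (∑ l, (G.r i l.castSucc - G.r i (Fin.last _)) * x i l)
      + ∑ k ∈ Finset.univ.filter (fun k => k ≠ i),
        ∑ l, (G.r k l.castSucc - G.r k (Fin.last _)) * x k l := by
    rw [Finset.filter_ne', Finset.add_sum_erase Finset.univ
      (fun k => ∑ l, (G.r k l.castSucc - G.r k (Fin.last _)) * x k l) (Finset.mem_univ i)]
  have tail : ∀ k, (∑ l, (G.r k l.castSucc - G.r k (Fin.last _)
        + G.Q i k (Fin.last _) l.castSucc - G.Q i k (Fin.last _) (Fin.last _)) * x k l) =
      (∑ l, (G.r k l.castSucc - G.r k (Fin.last _)) * x k l)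
      + ∑ l, (G.Q i k (Fin.last _) l.castSucc - G.Q i k (Fin.last _) (Fin.last _)) * x k l := by
    intro k
    rw [← Finset.sum_add_distrib]
    exact Finset.sum_congr rfl fun l _ => by ring
  simp only [utility, key, lin, rh, tail, Finset.sum_add_distrib, split]
  ring

/-- `l_{i,j}^τ(x) = (r̂_i^j + ∑_{k ≠ i} ⟨q̂_{ik}^j, x_k⟩ - τ ln x_i^j + τ ln (1 - ∑_ℓ x_i^ℓ))²`. -/
noncomputable def objective (G : SimplexGame N n) (τ : ℝ) (i : Fin N) (j : Fin (n i))
    (x : (i : Fin N) → Fin (n i) → ℝ) : ℝ :=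
  (G.rHat i j + (∑ k ∈ Finset.univ.filter (fun k => k ≠ i), ∑ l, G.qHat i k j l * x k l)
    - τ * Real.log (x i j) + τ * Real.log (1 - ∑ l, x i l)) ^ 2

/-- The set `S_{i,j}^τ` of stationary points of `l_{i,j}^τ` on `Δ̂^τ`; the number
`⟨∇ l_{i,j}^τ(x), y - x⟩` is the derivative of `l_{i,j}^τ` at `x` applied to `y - x`. -/
def stationary (G : SimplexGame N n) (τ : ℝ) (i : Fin N) (j : Fin (n i)) :
    Set ((i : Fin N) → Fin (n i) → ℝ) :=
  {x | x ∈ hatDelta n τ ∧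
    ∀ y ∈ hatDelta n τ, 0 ≤ fderiv ℝ (G.objective τ i j) x (y - x)}

/-- The set `S^τ = ⋂_i ⋂_j S_{i,j}^τ` of common stationary points on `Δ̂^τ`. -/
def commonStationary (G : SimplexGame N n) (τ : ℝ) : Set ((i : Fin N) → Fin (n i) → ℝ) :=
  ⋂ (i : Fin N) (j : Fin (n i)), G.stationary τ i j

end SimplexGame

/-! With the opponents fixed, a player maximizes a linear payoff plus `τ` times entropy. By the
Gibbs variational identity the gap to the maximum is `τ` times a Kullback–Leibler divergence, so the
unique best reply is the softmax of the payoffs divided by `τ`. Equilibria are thus fixed points of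
a bounded smooth map, and Brouwer's theorem gives one (`nashT_nonempty`).

Let `C` bound the payoffs, put `τ = b⁻²`, and let `s` be the eliminated last coordinate of player
`i`. The walls of `hatDelta` become `x i j = exp (-b ^ 4) / (m + 1)` and `s = exp (-b ^ 3) / (m +
1)`. For `b > C + 3` the softmax estimates put every equilibrium strictly inside them.

Each objective is `g ^ 2` with `g = gradT`, and the derivative of `g` along its own coordinate is
`-τ (1 / x i j + 1 / s) < 0`. Hence stationarity at an interior point means `g = 0`, and all these
equations together characterize equilibrium. On the walls, moving player `i` towards the uniform
action yields `g * (1 / x i j - 1 / s) ≤ 0` (`gradT_mul_le_zero_of_mem_stationary`). If `x i j` is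
at its wall, then `x i j < s`, the bracket is positive and `g ≥ b² - b - C > 0`. If `s` is at its
wall, some `x i j ≥ 1 / (m + 1) > s`, the bracket is negative and `g ≤ C - b < 0`. The gap between
the exponents `b ^ 4` and `b ^ 3` decides the first case. -/

open MeasureTheory Metric Set Filter Topology

/-! ### Brouwer's fixed point theorem by the Milnor–Rogers volume argument -/

theorem exists_det_one_add_interpolation (E : Type*) [NormedAddCommGroup E] [NormedSpace ℝ E]
    [FiniteDimensional ℝ E] {ε : ℝ} (hε : 0 < ε) :
    ∃ (s : Finset ℕ) (v w : ℕ → ℝ), (∀ k, 0 < v k ∧ v k ≤ ε) ∧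
      ∀ A : E →L[ℝ] E, (1 + A).det = ∑ k ∈ s, w k * (1 + v k • A).det := by
  classical
  -- `det (1 + t A)` is a polynomial in `t` of degree at most the dimension, so its values at
  -- dimension-many plus one nodes in `(0, ε]` determine its value at `t = 1`. The weights are the
  -- Lagrange basis polynomials at `1`, independent of `A`.
  let s := Finset.range (Module.finrank ℝ E + 1)
  let v : ℕ → ℝ := fun k => ε / (k + 1)
  have hv : Set.InjOn v s := by
    intro a _ b _ h
    have ha : (0 : ℝ) < a + 1 := by positivity
    have hb : (0 : ℝ) < b + 1 := by positivity
    have h' : ε / ((a : ℝ) + 1) = ε / (b + 1) := h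
    rw [div_eq_div_iff ha.ne' hb.ne'] at h'
    have := mul_left_cancel₀ hε.ne' h'
    exact_mod_cast (add_right_cancel this).symm
  refine ⟨s, v, fun k => (Lagrange.basis s v k).eval 1, fun k => ⟨by positivity, ?_⟩, fun A => ?_⟩
  · exact div_le_self hε.le (by linarith [(Nat.cast_nonneg k : (0 : ℝ) ≤ k)])
  · let b := Module.finBasis ℝ E
    let M := LinearMap.toMatrix b b (A : E →ₗ[ℝ] E)
    let p : Polynomial ℝ :=
      ((Polynomial.X : Polynomial ℝ) • M.map Polynomial.C + (1 : Matrix _ _ ℝ).map Polynomial.C).det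
    have hp : ∀ t : ℝ, p.eval t = (1 + t • A).det := by
      intro t
      rw [ContinuousLinearMap.det, ← LinearMap.det_toMatrix b, ← Polynomial.coe_evalRingHom,
        RingHom.map_det]
      congr 1
      ext i j
      simp [M, LinearMap.toMatrix_apply, Matrix.one_apply, Finsupp.single_apply, eq_comm, add_comm]
      split_ifs <;> simp <;> ring
    have hdeg : p.degree < s.card := by
      refine lt_of_le_of_lt Polynomial.degree_le_natDegree ?_
      have := Polynomial.natDegree_det_X_add_C_le M (1 : Matrix _ _ ℝ)
      rw [Fintype.card_fin] at this
      rw [Finset.card_range]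
      exact_mod_cast Nat.lt_succ_of_le this
    have h1 := hp 1
    rw [one_smul] at h1
    rw [← h1, Lagrange.eq_interpolate hv hdeg, Lagrange.interpolate_apply, Polynomial.eval_finsetSum]
    refine Finset.sum_congr rfl fun k _ => ?_
    rw [Polynomial.eval_mul, Polynomial.eval_C, hp, mul_comm]

/-- Extending by zero a map that vanishes on the unit sphere preserves its Lipschitz constant. -/
theorem LipschitzOnWith.indicator_closedBall {E : Type*} [NormedAddCommGroup E] [NormedSpace ℝ E]
    {K : NNReal} {g : E → E} (hg : LipschitzOnWith K g (closedBall 0 1))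
    (h0 : ∀ x ∈ sphere (0 : E) 1, g x = 0) :
    LipschitzWith K ((closedBall (0 : E) 1).indicator g) := by
  have key : ∀ x ∈ closedBall (0 : E) 1, ∀ y ∉ closedBall (0 : E) 1, dist (g x) 0 ≤ K * dist x y := by
    intro x hx y hy
    -- The segment from inside to outside crosses the sphere, where `g` vanishes, at a point no
    -- farther from `x` than `y` is.
    obtain ⟨z, hz, hz1⟩ : ∃ z ∈ segment ℝ x y, ‖z‖ = 1 := by
      have := (convex_segment x y).isPreconnected.intermediate_value (left_mem_segment ℝ x y)
        (right_mem_segment ℝ x y) (continuous_norm.continuousOn)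
      rw [mem_closedBall_zero_iff] at hx hy
      exact this ⟨hx, (not_le.1 hy).le⟩
    have hzs : z ∈ sphere (0 : E) 1 := by simpa using hz1
    rw [← h0 z hzs]
    refine (hg.dist_le_mul x hx z (sphere_subset_closedBall hzs)).trans ?_
    gcongr
    have := dist_add_dist_of_mem_segment hz
    linarith [dist_nonneg (x := z) (y := y)]
  refine LipschitzWith.of_dist_le_mul fun x y => ?_
  by_cases hx : x ∈ closedBall (0 : E) 1 <;> by_cases hy : y ∈ closedBall (0 : E) 1
  · rw [indicator_of_mem hx, indicator_of_mem hy]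
    exact hg.dist_le_mul x hx y hy
  · rw [indicator_of_mem hx, indicator_of_notMem hy]
    exact key x hx y hy
  · rw [indicator_of_notMem hx, indicator_of_mem hy, dist_comm, dist_comm x]
    exact key y hy x hx
  · rw [indicator_of_notMem hx, indicator_of_notMem hy, dist_self]
    positivity

/-- A perturbation of the identity by a contraction supported in a set is a bijection of the set. -/
theorem bijOn_id_add_of_lipschitz {E : Type*} [NormedAddCommGroup E] [CompleteSpace E]
    {K : NNReal} (hK : K < 1) {h : E → E} (hh : LipschitzWith K h) {s : Set E}
    (h0 : ∀ x ∉ s, h x = 0) : BijOn (fun x => x + h x) s s := by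
  have hinj : Function.Injective (fun x => x + h x) := by
    intro x y hxy
    have e : x - y = h y - h x := by
      have : x + h x = y + h y := hxy
      rw [sub_eq_sub_iff_add_eq_add, this, add_comm]
    have h1 : ‖x - y‖ ≤ K * ‖x - y‖ := by
      conv_lhs => rw [e]
      rw [norm_sub_rev x y]
      exact hh.norm_sub_le y x
    have h2 : (K : ℝ) < 1 := by exact_mod_cast hK
    have h3 : ‖x - y‖ = 0 := by nlinarith [norm_nonneg (x - y)]
    exact sub_eq_zero.1 (norm_eq_zero.1 h3)
  refine ⟨fun x hx => ?_, hinj.injOn, fun y hy => ?_⟩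
  -- Points outside `s` are fixed, so an image outside `s` would be its own preimage, and
  -- injectivity forces `x` itself outside.
  · by_contra hc
    have e : (x + h x) + h (x + h x) = x + h x := by rw [h0 _ hc, add_zero]
    have := hinj e
    exact hc (by change x + h x ∈ s; rwa [this])
  -- Solving `x + h x = y` is a fixed point problem for the contraction `x ↦ y - h x`; a solution
  -- outside `s` would be `y` itself.
  · have hc : ContractingWith K (fun x => y - h x) := by
      refine ⟨hK, LipschitzWith.of_dist_le_mul fun a b => ?_⟩
      rw [dist_sub_left]
      exact hh.dist_le_mul a b
    have hf := hc.fixedPoint_isFixedPt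
    set x := ContractingWith.fixedPoint _ hc
    have e : x + h x = y := by
      exact (sub_eq_iff_eq_add.1 (show y - h x = x from hf)).symm
    refine ⟨x, ?_, e⟩
    by_contra hx
    rw [h0 x hx, add_zero] at e
    exact hx (e ▸ hy)

section Brouwer

variable {E : Type*} [NormedAddCommGroup E] [InnerProductSpace ℝ E] [FiniteDimensional ℝ E]

/-- Differentiating `‖r‖² = 1` shows that the range of the derivative is orthogonal to `r x ≠ 0`, so
the derivative is not onto. -/
theorem det_fderiv_eq_zero_of_norm_eventually_eq_one {r : E → E} {x : E}
    (hr : DifferentiableAt ℝ r x) (h1 : ∀ᶠ y in 𝓝 x, ‖r y‖ = 1) : (fderiv ℝ r x).det = 0 := by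
  by_contra hdet
  have hsurj : Function.Surjective (fderiv ℝ r x) := by
    have hu : IsUnit (LinearMap.det (fderiv ℝ r x : E →ₗ[ℝ] E)) := isUnit_iff_ne_zero.2 hdet
    exact (LinearEquiv.ofIsUnitDet (f := (fderiv ℝ r x : E →ₗ[ℝ] E))
      (v := Module.finBasis ℝ E) (v' := Module.finBasis ℝ E)
      (by rw [LinearMap.det_toMatrix]; exact hu)).surjective
  obtain ⟨v, hv⟩ := hsurj (r x)
  have hd := hr.hasFDerivAt.norm_sq
  have hz : HasFDerivAt (fun y => ‖r y‖ ^ 2) (0 : E →L[ℝ] ℝ) x := by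
    refine (hasFDerivAt_const (1 : ℝ) x).congr_of_eventuallyEq ?_
    filter_upwards [h1] with y hy
    rw [hy, one_pow]
  have e := DFunLike.congr_fun (hd.unique hz) v
  simp only [smul_apply, ContinuousLinearMap.comp_apply, hv, innerSL_apply_apply,
    real_inner_self_eq_norm_sq, h1.self_of_nhds, zero_apply] at e
  norm_num at e

/-- There is no continuously differentiable retraction of the closed unit ball onto its sphere. -/
theorem not_exists_contDiffAt_retraction (r : E → E)
    (hr : ∀ x ∈ closedBall (0 : E) 1, ContDiffAt ℝ 1 r x)
    (h1 : ∀ x ∈ closedBall (0 : E) 1, ∀ᶠ y in 𝓝 x, ‖r y‖ = 1)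
    (hfix : ∀ x ∈ sphere (0 : E) 1, r x = x) : False := by
  borelize E
  set B := closedBall (0 : E) 1 with hB
  have hBc : IsCompact B := isCompact_closedBall 0 1
  let A : E → E →L[ℝ] E := fun x => fderiv ℝ r x - 1
  have hA : ContinuousOn A B := fun x hx =>
    ((((hr x hx).fderiv_right (m := 0) (by norm_num)).continuousAt).sub
      continuousAt_const).continuousWithinAt
  have hderiv : ∀ x ∈ B, HasFDerivAt (fun y => r y - y) (A x) x := fun x hx =>
    (((hr x hx).differentiableAt one_ne_zero).hasFDerivAt).sub (hasFDerivAt_id x)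
  obtain ⟨K₀, hK₀⟩ := hBc.exists_bound_of_continuousOn hA
  let K : NNReal := ⟨max K₀ 1, by positivity⟩
  have hK1 : (1 : ℝ) ≤ K := le_max_right _ _
  have hK : ∀ x ∈ B, ‖A x‖ ≤ K := fun x hx => (hK₀ x hx).trans (le_max_left _ _)
  have hlip : LipschitzOnWith K (fun y => r y - y) B :=
    (convex_closedBall (0 : E) 1).lipschitzOnWith_of_nnnorm_hasFDerivWithin_le
      (fun x hx => (hderiv x hx).hasFDerivWithinAt) fun x hx => by exact_mod_cast hK x hx
  have hind := hlip.indicator_closedBall fun x hx => by rw [hfix x hx, sub_self]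
  have hdetc : Continuous (fun M : E →L[ℝ] E => M.det) := ContinuousLinearMap.continuous_det
  obtain ⟨δ, hδ, hpos⟩ : ∃ δ > 0, ∀ M : E →L[ℝ] E, dist M 1 < δ → 0 < M.det := by
    have : ∀ᶠ M in 𝓝 (1 : E →L[ℝ] E), 0 < M.det := by
      refine hdetc.continuousAt.eventually (lt_mem_nhds ?_)
      simp [ContinuousLinearMap.det]
    exact Metric.eventually_nhds_iff.1 this
  have hK0 : (0 : ℝ) < K := lt_of_lt_of_le one_pos hK1
  -- The first bound makes `t (r - id)` a contraction, so `id + t (r - id)` permutes the ball; the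
  -- second keeps the Jacobian determinant positive, so that its integral is the volume of the ball.
  let ε : ℝ := min (1 / (2 * K)) (δ / (2 * K))
  have hε : 0 < ε := by positivity
  have hmeas : MeasurableSet B := isClosed_closedBall.measurableSet
  have hvol : ∀ t : ℝ, 0 < t → t ≤ ε →
      ∫ x in B, (1 + t • A x).det ∂volume = volume.real B := by
    intro t ht htε
    have htK : t * K < 1 := by
      have : t ≤ 1 / (2 * K) := htε.trans (min_le_left _ _)
      rw [le_div_iff₀ (by positivity)] at this
      linarith
    have htδ : t * K < δ := by
      have : t ≤ δ / (2 * K) := htε.trans (min_le_right _ _)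
      rw [le_div_iff₀ (by positivity)] at this
      linarith
    let t' : NNReal := ⟨t, ht.le⟩
    have hl : LipschitzWith (t' * K) (fun x => t • B.indicator (fun y => r y - y) x) := by
      refine LipschitzWith.of_dist_le_mul fun x y => ?_
      rw [dist_smul₀, NNReal.coe_mul, mul_assoc, Real.norm_of_nonneg ht.le]
      exact mul_le_mul_of_nonneg_left (hind.dist_le_mul x y) ht.le
    have hbij := bijOn_id_add_of_lipschitz (s := B) (by exact_mod_cast htK) hl
      fun x hx => by rw [indicator_of_notMem hx, smul_zero]
    have hbij' : BijOn (fun x => x + t • (r x - x)) B B := by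
      refine hbij.congr fun x hx => ?_
      simp only [indicator_of_mem hx]
    have hd : ∀ x ∈ B, HasFDerivWithinAt (fun x => x + t • (r x - x)) (1 + t • A x) B x :=
      fun x hx => ((hasFDerivAt_id x).add ((hderiv x hx).const_smul t)).hasFDerivWithinAt
    have hcv := integral_image_eq_integral_abs_det_fderiv_smul volume hmeas hd hbij'.injOn
      (fun _ => (1 : ℝ))
    rw [hbij'.image_eq] at hcv
    simp only [smul_eq_mul, mul_one, integral_const, MeasurableSet.univ, measureReal_restrict_apply,
      univ_inter] at hcv
    rw [hcv]
    refine setIntegral_congr_fun hmeas fun x hx => ?_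
    refine (abs_of_pos (hpos _ ?_)).symm
    rw [dist_eq_norm, add_sub_cancel_left, norm_smul, Real.norm_of_nonneg ht.le]
    exact (mul_le_mul_of_nonneg_left (hK x hx) ht.le).trans_lt htδ
  obtain ⟨s, v, w, hv, hw⟩ := exists_det_one_add_interpolation E hε
  have hint : ∀ t : ℝ, IntegrableOn (fun x => (1 + t • A x).det) B volume := fun t =>
    (hdetc.comp_continuousOn (continuousOn_const.add (hA.const_smul t))).integrableOn_compact hBc
  have hsum : ∑ k ∈ s, w k = 1 := by
    have := hw 0
    simpa [ContinuousLinearMap.det] using this.symm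
  -- Interpolation carries the volume identity from small `t` to `t = 1`, where `1 + A x` is the
  -- singular derivative of `r`.
  have hfinal : ∫ x in B, (1 + A x).det ∂volume = volume.real B := by
    rw [setIntegral_congr_fun hmeas fun x _ => hw (A x),
      integral_finsetSum _ fun k _ => (hint (v k)).const_mul (w k)]
    simp only [integral_const_mul, hvol _ (hv _).1 (hv _).2]
    rw [← Finset.sum_mul, hsum, one_mul]
  have hzero : ∫ x in B, (1 + A x).det ∂volume = 0 := by
    refine setIntegral_eq_zero_of_forall_eq_zero fun x hx => ?_
    simp only [A, add_sub_cancel]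
    exact det_fderiv_eq_zero_of_norm_eventually_eq_one
      ((hr x hx).differentiableAt one_ne_zero) (h1 x hx)
  have hpos : 0 < volume.real B := by
    refine ENNReal.toReal_pos ?_ hBc.measure_lt_top.ne
    exact (measure_closedBall_pos volume 0 one_pos).ne'
  rw [hzero] at hfinal
  exact hpos.ne hfinal

/-- **Brouwer's fixed point theorem** for continuously differentiable maps. -/
theorem exists_fixedPoint_of_contDiff {F : E → E} (hF : ContDiff ℝ 1 F) (hb : ∀ x, ‖F x‖ < 1) :
    ∃ x, F x = x := by
  by_contra! hne
  have hne' : ∀ x, x - F x ≠ 0 := fun x => sub_ne_zero.2 (hne x).symm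
  let a : E → ℝ := fun x => ‖x - F x‖ ^ 2
  let b : E → ℝ := fun x => inner ℝ x (x - F x)
  -- The retraction follows the ray from `F x` through `x`. `D` is a quarter of the discriminant of
  -- `‖x + c (x - F x)‖² = 1` in `c`; the larger root is taken, which is `0` on the sphere because
  -- `b > 0` there.
  let D : E → ℝ := fun x => b x ^ 2 + a x * (1 - ‖x‖ ^ 2)
  have ha : ∀ x, 0 < a x := fun x => by have := norm_pos_iff.2 (hne' x); positivity
  have hbpos : ∀ x, ‖x‖ = 1 → 0 < b x := by
    intro x hx
    simp only [b, inner_sub_right, real_inner_self_eq_norm_sq, hx]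
    have := real_inner_le_norm x (F x)
    rw [hx] at this
    linarith [hb x]
  have hD : ∀ x ∈ closedBall (0 : E) 1, 0 < D x := by
    intro x hx
    rw [mem_closedBall_zero_iff] at hx
    rcases hx.lt_or_eq with h | h
    · have : 0 < 1 - ‖x‖ ^ 2 := by nlinarith [norm_nonneg x]
      have := mul_pos (ha x) this
      positivity
    · have := hbpos x h
      simp only [D, h]
      positivity
  have hsub : ContDiff ℝ 1 (fun x => x - F x) := contDiff_id.sub hF
  have hac : ContDiff ℝ 1 a := hsub.norm_sq ℝ
  have hbc : ContDiff ℝ 1 b := contDiff_id.inner ℝ hsub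
  have hDc : ContDiff ℝ 1 D := (hbc.pow 2).add (hac.mul (contDiff_const.sub (contDiff_id.norm_sq ℝ)))
  let r : E → E := fun x => x + ((Real.sqrt (D x) - b x) / a x) • (x - F x)
  refine not_exists_contDiffAt_retraction r (fun x hx => ?_) (fun x hx => ?_) (fun x hx => ?_)
  · exact contDiffAt_id.add ((((hDc.contDiffAt.sqrt (hD x hx).ne').sub hbc.contDiffAt).div
      hac.contDiffAt (ha x).ne').smul hsub.contDiffAt)
  · filter_upwards [hDc.continuous.continuousAt.eventually (lt_mem_nhds (hD x hx))] with y hy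
    have hs := Real.sq_sqrt hy.le
    set q := Real.sqrt (D y)
    have h2 : ‖r y‖ ^ 2 = 1 := by
      simp only [r]
      rw [norm_add_sq_real, norm_smul, inner_smul_right, mul_pow, Real.norm_eq_abs, sq_abs]
      change ‖y‖ ^ 2 + 2 * ((q - b y) / a y * b y) + ((q - b y) / a y) ^ 2 * a y = 1
      have hay := (ha y).ne'
      field_simp
      have : q ^ 2 = b y ^ 2 + a y * (1 - ‖y‖ ^ 2) := hs
      linear_combination this
    rw [← sq_eq_sq₀ (norm_nonneg _) zero_le_one, h2, one_pow]
  · rw [mem_sphere_zero_iff_norm] at hx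
    have : D x = b x ^ 2 := by simp [D, hx]
    simp only [r, this, Real.sqrt_sq (hbpos x hx).le, sub_self, zero_div, zero_smul, add_zero]

theorem exists_fixedPoint_of_contDiff_of_norm_lt {F : E → E} (hF : ContDiff ℝ 1 F) {R : ℝ}
    (hb : ∀ x, ‖F x‖ < R) : ∃ x, F x = x := by
  have hR : 0 < R := (norm_nonneg _).trans_lt (hb 0)
  obtain ⟨x, hx⟩ := exists_fixedPoint_of_contDiff (F := fun x => R⁻¹ • F (R • x))
    ((hF.comp (contDiff_id.const_smul R)).const_smul R⁻¹) fun x => by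
      rw [norm_smul, norm_inv, Real.norm_of_nonneg hR.le, inv_mul_lt_iff₀ hR, mul_one]
      exact hb _
  refine ⟨R • x, ?_⟩
  conv_rhs => rw [← hx, smul_inv_smul₀ hR.ne']

end Brouwer

/-! ### Entropy-regularized linear maximization and softmax -/

open Real Set Filter Topology

section Softmax

variable {m : ℕ}

/-- The maximizer of `∑ j, h j * z j` plus the entropy, without its last coordinate; the payoff of
the last coordinate is `0`. -/
noncomputable def softmaxT (h : Fin m → ℝ) : Fin m → ℝ :=
  fun j => exp (h j) / (1 + ∑ l, exp (h l))

theorem one_add_sum_exp_pos (h : Fin m → ℝ) : 0 < 1 + ∑ l, exp (h l) := by positivity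

theorem softmaxT_pos (h : Fin m → ℝ) (j : Fin m) : 0 < softmaxT h j :=
  div_pos (exp_pos _) (one_add_sum_exp_pos h)

theorem one_sub_sum_softmaxT (h : Fin m → ℝ) :
    1 - ∑ j, softmaxT h j = 1 / (1 + ∑ l, exp (h l)) := by
  have := (one_add_sum_exp_pos h).ne'
  simp only [softmaxT, ← Finset.sum_div]
  field_simp
  ring

theorem one_sub_sum_softmaxT_pos (h : Fin m → ℝ) : 0 < 1 - ∑ j, softmaxT h j := by
  rw [one_sub_sum_softmaxT]
  exact one_div_pos.2 (one_add_sum_exp_pos h)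

theorem softmaxT_lt_one (h : Fin m → ℝ) (j : Fin m) : softmaxT h j < 1 := by
  have h1 := one_sub_sum_softmaxT_pos h
  have h2 := Finset.single_le_sum (f := softmaxT h) (fun l _ => (softmaxT_pos h l).le)
    (Finset.mem_univ j)
  linarith

theorem softmaxT_mem_actionSetT (h : Fin m → ℝ) : softmaxT h ∈ SimplexGame.actionSetT m :=
  ⟨fun j => (softmaxT_pos h j).le, by linarith [one_sub_sum_softmaxT_pos h]⟩

theorem log_softmaxT (h : Fin m → ℝ) (j : Fin m) :
    log (softmaxT h j) = h j - log (1 + ∑ l, exp (h l)) := by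
  rw [softmaxT, log_div (exp_pos _).ne' (one_add_sum_exp_pos h).ne', log_exp]

theorem log_one_sub_sum_softmaxT (h : Fin m → ℝ) :
    log (1 - ∑ j, softmaxT h j) = - log (1 + ∑ l, exp (h l)) := by
  rw [one_sub_sum_softmaxT, one_div, log_inv]

/-- The equations say `z j = s * exp (h j)` with `s` the last coordinate; total mass one then fixes
`s`. -/
theorem eq_softmaxT_of_log_eq {h z : Fin m → ℝ} (hz : ∀ j, 0 < z j) (hs : 0 < 1 - ∑ j, z j)
    (hl : ∀ j, h j - log (z j) + log (1 - ∑ l, z l) = 0) : z = softmaxT h := by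
  set s := 1 - ∑ j, z j with hsdef
  have e : ∀ j, z j = s * exp (h j) := fun j => by
    rw [← exp_log (hz j), show log (z j) = log s + h j by linarith [hl j], exp_add, exp_log hs]
  have hsum : s * (1 + ∑ l, exp (h l)) = 1 := by
    rw [mul_add, Finset.mul_sum, mul_one, ← Finset.sum_congr rfl fun j _ => e j, hsdef]
    ring
  funext j
  rw [softmaxT, eq_div_iff (one_add_sum_exp_pos h).ne', e j]
  linear_combination exp (h j) * hsum

/-- Linear payoff plus entropy on the simplex with its last coordinate eliminated. -/
noncomputable def freeEnergy (h z : Fin m → ℝ) : ℝ :=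
  (∑ j, h j * z j) - ((∑ j, z j * log (z j)) + (1 - ∑ j, z j) * log (1 - ∑ j, z j))

theorem mul_klFun_div {p : ℝ} (hp : 0 < p) (z : ℝ) :
    p * InformationTheory.klFun (z / p) = z * log z - z * log p + p - z := by
  rw [InformationTheory.klFun]
  rcases eq_or_ne z 0 with rfl | hz
  · simp
  · rw [log_div hz hp.ne']
    field_simp

/-- The Gibbs variational identity. -/
theorem freeEnergy_eq (h z : Fin m → ℝ) :
    freeEnergy h z = log (1 + ∑ l, exp (h l)) -
      ((∑ j, softmaxT h j * InformationTheory.klFun (z j / softmaxT h j)) +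
        (1 - ∑ j, softmaxT h j) *
          InformationTheory.klFun ((1 - ∑ j, z j) / (1 - ∑ j, softmaxT h j))) := by
  simp only [mul_klFun_div (softmaxT_pos h _), mul_klFun_div (one_sub_sum_softmaxT_pos h),
    log_softmaxT, log_one_sub_sum_softmaxT, mul_sub, Finset.sum_sub_distrib, Finset.sum_add_distrib,
    ← Finset.sum_mul, freeEnergy]
  rw [Finset.sum_congr rfl fun j _ => mul_comm (h j) (z j)]
  ring

theorem freeEnergy_softmaxT (h : Fin m → ℝ) :
    freeEnergy h (softmaxT h) = log (1 + ∑ l, exp (h l)) := by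
  rw [freeEnergy_eq]
  simp [div_self (softmaxT_pos h _).ne', div_self (one_sub_sum_softmaxT_pos h).ne',
    InformationTheory.klFun_one]

/-- In `freeEnergy_eq` the deficit is a sum of nonnegative terms, each zero only where `z` agrees
with the softmax. No derivative is taken, so boundary points need no separate treatment. -/
theorem isMaxOn_freeEnergy_iff {h z : Fin m → ℝ} (hz : z ∈ SimplexGame.actionSetT m) :
    IsMaxOn (freeEnergy h) (SimplexGame.actionSetT m) z ↔ z = softmaxT h := by
  have hkl : ∀ y ∈ SimplexGame.actionSetT m, ∀ j,
      0 ≤ softmaxT h j * InformationTheory.klFun (y j / softmaxT h j) := fun y hy j =>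
    mul_nonneg (softmaxT_pos h j).le
      (InformationTheory.klFun_nonneg (div_nonneg (hy.1 j) (softmaxT_pos h j).le))
  have hkl' : ∀ y ∈ SimplexGame.actionSetT m, 0 ≤ (1 - ∑ j, softmaxT h j) *
      InformationTheory.klFun ((1 - ∑ j, y j) / (1 - ∑ j, softmaxT h j)) := fun y hy =>
    mul_nonneg (one_sub_sum_softmaxT_pos h).le (InformationTheory.klFun_nonneg
      (div_nonneg (by linarith [hy.2]) (one_sub_sum_softmaxT_pos h).le))
  constructor
  · intro hmax
    have h1 : freeEnergy h (softmaxT h) ≤ freeEnergy h z := hmax (softmaxT_mem_actionSetT h)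
    rw [freeEnergy_softmaxT, freeEnergy_eq h z] at h1
    have h2 : ∑ j, softmaxT h j * InformationTheory.klFun (z j / softmaxT h j) = 0 :=
      le_antisymm (by linarith [hkl' z hz]) (Finset.sum_nonneg fun j _ => hkl z hz j)
    rw [Finset.sum_eq_zero_iff_of_nonneg fun j _ => hkl z hz j] at h2
    funext j
    have h3 := (mul_eq_zero.1 (h2 j (Finset.mem_univ j))).resolve_left (softmaxT_pos h j).ne'
    rw [InformationTheory.klFun_eq_zero_iff (div_nonneg (hz.1 j) (softmaxT_pos h j).le),
      div_eq_one_iff_eq (softmaxT_pos h j).ne'] at h3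
    exact h3
  · rintro rfl y hy
    change freeEnergy h y ≤ freeEnergy h (softmaxT h)
    rw [freeEnergy_softmaxT, freeEnergy_eq h y]
    linarith [hkl' y hy, Finset.sum_nonneg fun j (_ : j ∈ Finset.univ) => hkl y hy j]

theorem sum_exp_le {h : Fin m → ℝ} {c : ℝ} (hc : 0 ≤ c) (hh : ∀ j, h j ≤ c) :
    1 + ∑ l, exp (h l) ≤ (m + 1) * exp c := by
  have h1 : ∑ l, exp (h l) ≤ ∑ _l : Fin m, exp c :=
    Finset.sum_le_sum fun l _ => exp_le_exp.2 (hh l)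
  rw [Finset.sum_const, Finset.card_univ, Fintype.card_fin, nsmul_eq_mul] at h1
  linarith [one_le_exp hc]

/-- The numerator is at least `exp (-c)` and the denominator at most `(m + 1) * exp c`, whence the
factor `2`. The last coordinate has numerator `1` and loses only `exp (-c)`. -/
theorem le_softmaxT {h : Fin m → ℝ} {c : ℝ} (hc : 0 ≤ c) (hh : ∀ j, |h j| ≤ c) (j : Fin m) :
    exp (-(2 * c)) / (m + 1) ≤ softmaxT h j := by
  have h1 := sum_exp_le hc fun j => (abs_le.1 (hh j)).2
  calc exp (-(2 * c)) / (m + 1) = exp (-c) / ((m + 1) * exp c) := by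
        rw [show -(2 * c) = -c - c by ring, exp_sub, div_div, mul_comm]
    _ ≤ softmaxT h j := by
        have := one_add_sum_exp_pos h
        have := (abs_le.1 (hh j)).1
        unfold softmaxT
        gcongr

theorem le_one_sub_sum_softmaxT {h : Fin m → ℝ} {c : ℝ} (hc : 0 ≤ c) (hh : ∀ j, |h j| ≤ c) :
    exp (-c) / (m + 1) ≤ 1 - ∑ j, softmaxT h j := by
  have h1 := sum_exp_le hc fun j => (abs_le.1 (hh j)).2
  rw [one_sub_sum_softmaxT, exp_neg, inv_eq_one_div, div_div, mul_comm]
  exact one_div_le_one_div_of_le (one_add_sum_exp_pos h) h1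

end Softmax

/-! ### Nash equilibria as softmax fixed points -/

namespace SimplexGame

variable {N : ℕ} {n : Fin N → ℕ}

/-- The coefficient of `x_i^j` in the transformed unregularized utility of player `i`. -/
noncomputable def payoff (G : SimplexGame N n) (i : Fin N) (j : Fin (n i))
    (x : (i : Fin N) → Fin (n i) → ℝ) : ℝ :=
  G.rHat i j + ∑ k ∈ Finset.univ.filter (fun k => k ≠ i), ∑ l, G.qHat i k j l * x k l

/-- A bound for `|payoff|` on profiles with coordinates in `[0, 1]`. -/
noncomputable def payoffBound (G : SimplexGame N n) : ℝ :=
  ∑ i, ∑ j, (|G.rHat i j| + ∑ k ∈ Finset.univ.filter (fun k => k ≠ i), ∑ l, |G.qHat i k j l|)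

theorem payoffBound_nonneg (G : SimplexGame N n) : 0 ≤ G.payoffBound := by
  unfold payoffBound
  positivity

theorem abs_payoff_le (G : SimplexGame N n) {x : (i : Fin N) → Fin (n i) → ℝ}
    (hx : ∀ i, x i ∈ actionSetT (n i)) (i : Fin N) (j : Fin (n i)) :
    |G.payoff i j x| ≤ G.payoffBound := by
  have hx1 : ∀ k l, |x k l| ≤ 1 := fun k l => by
    rw [abs_of_nonneg ((hx k).1 l)]
    exact (Finset.single_le_sum (f := x k) (fun l _ => (hx k).1 l) (Finset.mem_univ l)).trans (hx k).2
  let T : (i : Fin N) → Fin (n i) → ℝ := fun i j =>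
    |G.rHat i j| + ∑ k ∈ Finset.univ.filter (fun k => k ≠ i), ∑ l, |G.qHat i k j l|
  have hT : ∀ i j, 0 ≤ T i j := fun i j => by positivity
  have h1 : |G.payoff i j x| ≤ T i j := by
    refine (abs_add_le _ _).trans (add_le_add_right ?_ _)
    refine (Finset.abs_sum_le_sum_abs _ _).trans (Finset.sum_le_sum fun k _ => ?_)
    refine (Finset.abs_sum_le_sum_abs _ _).trans (Finset.sum_le_sum fun l _ => ?_)
    rw [abs_mul]
    exact mul_le_of_le_one_right (abs_nonneg _) (hx1 k l)
  exact (h1.trans (Finset.single_le_sum (f := T i) (fun j _ => hT i j) (Finset.mem_univ j))).trans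
    (Finset.single_le_sum (f := fun i => ∑ j, T i j)
      (fun i _ => Finset.sum_nonneg fun j _ => hT i j) (Finset.mem_univ i))

/-- In `utility_lift` the terms outside the own-action part involve only opponents; they form the
constant `c`. -/
theorem exists_regUtilityT_update_eq (G : SimplexGame N n) {τ : ℝ} (hτ : τ ≠ 0) (i : Fin N)
    (x : (i : Fin N) → Fin (n i) → ℝ) :
    ∃ c, ∀ z : Fin (n i) → ℝ, G.regUtilityT τ i (Function.update x i z) =
      τ * freeEnergy (fun j => G.payoff i j x / τ) z + c := by
  refine ⟨(∑ k ∈ Finset.univ.filter (fun k => k ≠ i),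
          ((∑ l, (G.r k l.castSucc - G.r k (Fin.last _) + G.Q i k (Fin.last _) l.castSucc
              - G.Q i k (Fin.last _) (Fin.last _)) * x k l)
            + G.Q i k (Fin.last _) (Fin.last _)))
        + ∑ j, G.r j (Fin.last _), fun z => ?_⟩
  have h1 : (∑ k ∈ Finset.univ.filter (fun k => k ≠ i),
      ∑ j, ∑ l, Function.update x i z i j * G.qHat i k j l * Function.update x i z k l)
      + ∑ j, G.rHat i j * Function.update x i z i j = ∑ j, G.payoff i j x * z j := by
    rw [Finset.sum_comm, ← Finset.sum_add_distrib]
    refine Finset.sum_congr rfl fun j _ => ?_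
    rw [Function.update_self, payoff, add_mul, add_comm, Finset.sum_mul]
    congr 1
    refine Finset.sum_congr rfl fun k hk => ?_
    rw [Function.update_of_ne (Finset.mem_filter.1 hk).2, Finset.sum_mul]
    exact Finset.sum_congr rfl fun l _ => by ring
  have h2 : ∑ j, G.payoff i j x * z j = τ * ∑ j, G.payoff i j x / τ * z j := by
    rw [Finset.mul_sum]
    exact Finset.sum_congr rfl fun j _ => by field_simp
  have h3 : ∀ (c : (k : Fin N) → Fin (n k) → ℝ) (d : Fin N → ℝ),
      ∑ k ∈ Finset.univ.filter (fun k => k ≠ i),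
        ((∑ l, c k l * Function.update x i z k l) + d k) =
      ∑ k ∈ Finset.univ.filter (fun k => k ≠ i), ((∑ l, c k l * x k l) + d k) := fun c d =>
    Finset.sum_congr rfl fun k hk => by rw [Function.update_of_ne (Finset.mem_filter.1 hk).2]
  rw [regUtilityT, regUtility, utility_lift, h1, h2, h3 (fun k l => G.r k l.castSucc -
    G.r k (Fin.last _) + G.Q i k (Fin.last _) l.castSucc - G.Q i k (Fin.last _) (Fin.last _))]
  simp only [lift, Fin.sum_univ_castSucc, Fin.snoc_castSucc, Fin.snoc_last, Function.update_self,
    freeEnergy]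
  ring

theorem mem_nashT_iff (G : SimplexGame N n) {τ : ℝ} (hτ : 0 < τ)
    {x : (i : Fin N) → Fin (n i) → ℝ} :
    x ∈ G.nashT τ ↔ ∀ i, x i = softmaxT (fun j => G.payoff i j x / τ) := by
  have key : ∀ i, x i ∈ actionSetT (n i) → ((∀ z ∈ actionSetT (n i),
      G.regUtilityT τ i (Function.update x i z) ≤ G.regUtilityT τ i x) ↔
      x i = softmaxT (fun j => G.payoff i j x / τ)) := by
    intro i hi
    obtain ⟨c, hc⟩ := G.exists_regUtilityT_update_eq hτ.ne' i x
    have hx := hc (x i)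
    rw [Function.update_eq_self] at hx
    rw [← isMaxOn_freeEnergy_iff hi, isMaxOn_iff]
    refine forall₂_congr fun z _ => ?_
    rw [hc, hx, add_le_add_iff_right, mul_le_mul_iff_right₀ hτ]
  constructor
  · exact fun h i => (key i (h.1 i)).1 (h.2 i)
  · intro h
    have h' : ∀ i, x i ∈ actionSetT (n i) := fun i => by
      rw [h i]; exact softmaxT_mem_actionSetT _
    exact ⟨h', fun i => (key i (h' i)).2 (h i)⟩

/-- The softmax reply map is smooth on the whole Euclidean space with coordinates in `(0, 1)`, so
the smooth Brouwer theorem on a large ball suffices. -/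
theorem nashT_nonempty (G : SimplexGame N n) {τ : ℝ} (hτ : 0 < τ) : (G.nashT τ).Nonempty := by
  let F : EuclideanSpace ℝ (Σ i, Fin (n i)) → EuclideanSpace ℝ (Σ i, Fin (n i)) := fun y => WithLp.toLp 2 fun a =>
    softmaxT (fun j => G.payoff a.1 j (fun i l => y ⟨i, l⟩) / τ) a.2
  have hF : ContDiff ℝ 1 F := by
    rw [contDiff_euclidean]
    intro a
    have hp : ∀ j, ContDiff ℝ 1 fun y : EuclideanSpace ℝ (Σ i, Fin (n i)) =>
        exp (G.payoff a.1 j (fun i l => y ⟨i, l⟩) / τ) := by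
      intro j
      unfold payoff
      fun_prop
    exact (hp a.2).div (contDiff_const.add (ContDiff.sum fun j _ => hp j))
      fun y => (one_add_sum_exp_pos _).ne'
  obtain ⟨y, hy⟩ := exists_fixedPoint_of_contDiff_of_norm_lt hF
    (R := √(Fintype.card (Σ i, Fin (n i))) + 1) fun y => by
      refine lt_of_le_of_lt ?_ (lt_add_one _)
      rw [EuclideanSpace.norm_eq]
      refine Real.sqrt_le_sqrt ?_
      rw [← nsmul_one, ← Finset.card_univ]
      refine Finset.sum_le_card_nsmul _ _ _ fun a _ => ?_
      rw [Real.norm_eq_abs, sq_abs]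
      change softmaxT (fun j => G.payoff a.1 j (fun i l => y ⟨i, l⟩) / τ) a.2 ^ 2 ≤ 1
      exact pow_le_one₀ (softmaxT_pos _ _).le (softmaxT_lt_one _ _).le
  refine ⟨fun i l => y ⟨i, l⟩, (G.mem_nashT_iff hτ).2 fun i => funext fun j => ?_⟩
  exact (congrArg (fun v : EuclideanSpace ℝ (Σ i, Fin (n i)) => v ⟨i, j⟩) hy).symm

/-! ### Stationarity of the squared partial derivatives -/

/-- The partial derivative of the transformed regularized utility of player `i` in `x_i^j`. -/
noncomputable def gradT (G : SimplexGame N n) (τ : ℝ) (i : Fin N) (j : Fin (n i))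
    (x : (i : Fin N) → Fin (n i) → ℝ) : ℝ :=
  G.payoff i j x - τ * log (x i j) + τ * log (1 - ∑ l, x i l)

theorem mem_nashT_iff_gradT_eq_zero (G : SimplexGame N n) {τ : ℝ} (hτ : 0 < τ)
    {x : (i : Fin N) → Fin (n i) → ℝ} (hx : ∀ i j, 0 < x i j) (hs : ∀ i, 0 < 1 - ∑ l, x i l) :
    x ∈ G.nashT τ ↔ ∀ i j, G.gradT τ i j x = 0 := by
  rw [G.mem_nashT_iff hτ]
  refine forall_congr' fun i => ⟨fun h j => ?_, fun h => ?_⟩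
  · rw [gradT, h, log_softmaxT, log_one_sub_sum_softmaxT]
    field_simp
    ring
  · refine eq_softmaxT_of_log_eq (hx i) (hs i) fun j => ?_
    have := h j
    rw [gradT] at this
    field_simp
    linarith

/-- The payoff of player `i` does not depend on `x i`, so along player `i`'s own directions only the
two logarithms contribute. -/
theorem exists_hasFDerivAt_gradT (G : SimplexGame N n) (τ : ℝ) (i : Fin N) (j : Fin (n i))
    {x : (i : Fin N) → Fin (n i) → ℝ} (hx : x i j ≠ 0) (hs : 1 - ∑ l, x i l ≠ 0) :
    ∃ L : ((i : Fin N) → Fin (n i) → ℝ) →L[ℝ] ℝ, HasFDerivAt (G.gradT τ i j) L x ∧ ∀ u : Fin (n i) → ℝ,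
      L (Pi.single i u) = -τ * (u j / x i j + (∑ l, u l) / (1 - ∑ l, x i l)) := by
  let P : (k : Fin N) → (l : Fin (n k)) → ((i : Fin N) → Fin (n i) → ℝ) →L[ℝ] ℝ := fun k l =>
    (ContinuousLinearMap.proj (R := ℝ) (φ := fun _ : Fin (n k) => ℝ) l).comp
      (ContinuousLinearMap.proj (R := ℝ) (φ := fun i : Fin N => Fin (n i) → ℝ) k)
  have hP : ∀ k l, HasFDerivAt (fun x : (i : Fin N) → Fin (n i) → ℝ => x k l) (P k l) x :=
    fun k l => (P k l).hasFDerivAt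
  have h1 : HasFDerivAt (G.payoff i j)
      (∑ k ∈ Finset.univ.filter (fun k => k ≠ i), ∑ l, G.qHat i k j l • P k l) x := by
    unfold payoff
    exact (HasFDerivAt.fun_sum fun k _ => HasFDerivAt.fun_sum fun l _ =>
      (hP k l).const_mul (G.qHat i k j l)).const_add (G.rHat i j)
  have h2 := ((hP i j).log hx).const_mul τ
  have h3 := (((HasFDerivAt.fun_sum fun l (_ : l ∈ Finset.univ) => hP i l).const_sub 1).log
    hs).const_mul τ
  refine ⟨_, (h1.sub h2).add h3, fun u => ?_⟩
  have h4 : (∑ k ∈ Finset.univ.filter (fun k => k ≠ i), ∑ l, G.qHat i k j l • P k l)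
      (Pi.single i u) = 0 := by
    simp only [sum_apply]
    refine Finset.sum_eq_zero fun k hk => Finset.sum_eq_zero fun l _ => ?_
    simp [P, Pi.single_eq_of_ne (Finset.mem_filter.1 hk).2]
  simp only [add_apply, sub_apply, smul_apply, neg_apply, sum_apply, h4]
  simp [P]
  ring

theorem exists_hasFDerivAt_objective (G : SimplexGame N n) (τ : ℝ) (i : Fin N) (j : Fin (n i))
    {x : (i : Fin N) → Fin (n i) → ℝ} (hx : x i j ≠ 0) (hs : 1 - ∑ l, x i l ≠ 0) :
    ∃ L : ((i : Fin N) → Fin (n i) → ℝ) →L[ℝ] ℝ,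
      fderiv ℝ (G.objective τ i j) x = (2 * G.gradT τ i j x) • L ∧ ∀ u : Fin (n i) → ℝ,
      L (Pi.single i u) = -τ * (u j / x i j + (∑ l, u l) / (1 - ∑ l, x i l)) := by
  obtain ⟨L, hL, hu⟩ := G.exists_hasFDerivAt_gradT τ i j hx hs
  refine ⟨L, ?_, hu⟩
  have e : G.objective τ i j = fun x => G.gradT τ i j x ^ 2 := rfl
  rw [e, (hL.pow 2).fderiv]
  simp

/-- The profiles of `hatDelta` at which all the defining inequalities are strict. -/
def strictHatDelta (n : Fin N → ℕ) (τ : ℝ) : Set ((i : Fin N) → Fin (n i) → ℝ) :=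
  {x | ∀ i, (∀ j, exp (-1 / τ ^ 2) / (maxDim n + 1 : ℝ) < x i j) ∧
    ∑ j, x i j < 1 - exp (-1 / τ ^ (3 / 2 : ℝ)) / (maxDim n + 1 : ℝ)}

theorem isOpen_strictHatDelta (n : Fin N → ℕ) (τ : ℝ) : IsOpen (strictHatDelta n τ) := by
  simp only [strictHatDelta, ofPred_forall, ofPred_and]
  refine isOpen_iInter_of_finite fun i => IsOpen.inter (isOpen_iInter_of_finite fun j => ?_) ?_
  · exact isOpen_lt continuous_const (by fun_prop)
  · exact isOpen_lt (by fun_prop) continuous_const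

theorem strictHatDelta_subset_interior (n : Fin N → ℕ) (τ : ℝ) :
    strictHatDelta n τ ⊆ interior (hatDelta n τ) :=
  interior_maximal (fun _ hx i => ⟨fun j => ((hx i).1 j).le, (hx i).2.le⟩)
    (isOpen_strictHatDelta n τ)

theorem le_maxDim (n : Fin N → ℕ) (i : Fin N) : n i ≤ maxDim n :=
  Finset.le_sup (f := n) (Finset.mem_univ i)

theorem pos_of_mem_hatDelta {τ : ℝ} {x : (i : Fin N) → Fin (n i) → ℝ} (hx : x ∈ hatDelta n τ)
    (i : Fin N) (j : Fin (n i)) : 0 < x i j :=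
  lt_of_lt_of_le (by positivity) ((hx i).1 j)

theorem one_sub_sum_pos_of_mem_hatDelta {τ : ℝ} {x : (i : Fin N) → Fin (n i) → ℝ}
    (hx : x ∈ hatDelta n τ) (i : Fin N) : 0 < 1 - ∑ l, x i l := by
  have h1 := (hx i).2
  have h2 : 0 < exp (-1 / τ ^ (3 / 2 : ℝ)) / (maxDim n + 1 : ℝ) := by positivity
  linarith

theorem mem_actionSetT_of_mem_hatDelta {τ : ℝ} {x : (i : Fin N) → Fin (n i) → ℝ}
    (hx : x ∈ hatDelta n τ) (i : Fin N) : x i ∈ actionSetT (n i) :=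
  ⟨fun j => (pos_of_mem_hatDelta hx i j).le, by linarith [one_sub_sum_pos_of_mem_hatDelta hx i]⟩

theorem update_sub_eq_single (x : (i : Fin N) → Fin (n i) → ℝ) (i : Fin N) (w : Fin (n i) → ℝ) :
    Function.update x i w - x = Pi.single i (w - x i) := by
  funext k
  rcases eq_or_ne k i with rfl | hk
  · simp
  · simp [hk]

theorem exp_neg_div_le {a m : ℝ} {k : ℕ} (ha : 0 ≤ a) (hk : (k : ℝ) ≤ m) :
    exp (-1 / a) / (m + 1) ≤ 1 / (k + 1) := by
  have h1 : exp (-1 / a) ≤ 1 := by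
    rw [exp_le_one_iff, neg_div]
    exact neg_nonpos.2 (by positivity)
  gcongr

/-- The stationarity inequality in the direction of the uniform action of player `i`. -/
theorem gradT_mul_le_zero_of_mem_stationary (G : SimplexGame N n) {τ : ℝ} (hτ : 0 < τ) {i : Fin N}
    {j : Fin (n i)} {x : (i : Fin N) → Fin (n i) → ℝ} (hx : x ∈ G.stationary τ i j) :
    G.gradT τ i j x * (1 / x i j - 1 / (1 - ∑ l, x i l)) ≤ 0 := by
  obtain ⟨hmem, hstat⟩ := hx
  have hxj := pos_of_mem_hatDelta hmem i j
  have hs := one_sub_sum_pos_of_mem_hatDelta hmem i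
  have hni : (n i : ℝ) ≤ maxDim n := by exact_mod_cast le_maxDim n i
  have hc : (0 : ℝ) < 1 / ((n i : ℝ) + 1) := by positivity
  let w : Fin (n i) → ℝ := fun _ => 1 / ((n i : ℝ) + 1)
  have hw : ∑ l, w l = 1 - 1 / ((n i : ℝ) + 1) := by
    simp only [w, Finset.sum_const, Finset.card_univ, Fintype.card_fin, nsmul_eq_mul]
    field_simp
    ring
  have hy : Function.update x i w ∈ hatDelta n τ := by
    intro k
    rcases eq_or_ne k i with rfl | hk
    · rw [Function.update_self, hw]
      have h1 := exp_neg_div_le (a := τ ^ (3 / 2 : ℝ)) (by positivity) hni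
      exact ⟨fun _ => exp_neg_div_le (by positivity) hni, by linarith⟩
    · rw [Function.update_of_ne hk]
      exact hmem k
  obtain ⟨L, hL, hu⟩ := G.exists_hasFDerivAt_objective τ i j hxj.ne' hs.ne'
  have h := hstat _ hy
  rw [update_sub_eq_single, hL, smul_apply, hu, smul_eq_mul] at h
  -- The uniform action has the same value `1 / (n i + 1)` in every coordinate, including the
  -- eliminated one, so the constants `-1` and `+1` cancel and the value factors out.
  have e : (w - x i) j / x i j + (∑ l, (w - x i) l) / (1 - ∑ l, x i l) =
      1 / ((n i : ℝ) + 1) * (1 / x i j - 1 / (1 - ∑ l, x i l)) := by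
    simp only [Pi.sub_apply, Finset.sum_sub_distrib, hw]
    rw [show (1 - 1 / ((n i : ℝ) + 1) - ∑ l, x i l) =
      (1 - ∑ l, x i l) - 1 / ((n i : ℝ) + 1) by ring]
    simp only [w, sub_div, div_self hxj.ne', div_self hs.ne']
    ring
  rw [e] at h
  by_contra! hpos
  have : 0 < 2 * τ * (1 / ((n i : ℝ) + 1)) *
    (G.gradT τ i j x * (1 / x i j - 1 / (1 - ∑ l, x i l))) := by positivity
  linarith

/-- At an interior point the derivative `2 g L` vanishes in every direction, and `L` is negative on
the coordinate direction of `x i j`. -/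
theorem gradT_eq_zero_of_mem_stationary_of_mem_interior (G : SimplexGame N n) {τ : ℝ} (hτ : 0 < τ)
    {i : Fin N} {j : Fin (n i)} {x : (i : Fin N) → Fin (n i) → ℝ} (hx : x ∈ G.stationary τ i j)
    (hint : x ∈ interior (hatDelta n τ)) : G.gradT τ i j x = 0 := by
  obtain ⟨hmem, hstat⟩ := hx
  have hxj := pos_of_mem_hatDelta hmem i j
  have hs := one_sub_sum_pos_of_mem_hatDelta hmem i
  obtain ⟨L, hL, hu⟩ := G.exists_hasFDerivAt_objective τ i j hxj.ne' hs.ne'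
  have hdir : ∀ v, 0 ≤ fderiv ℝ (G.objective τ i j) x v := by
    intro v
    have hc : Tendsto (fun t : ℝ => x + t • v) (𝓝[>] 0) (𝓝 x) := by
      have : Continuous (fun t : ℝ => x + t • v) := by fun_prop
      simpa using (this.tendsto 0).mono_left nhdsWithin_le_nhds
    obtain ⟨t, ht, ht0⟩ := ((hc.eventually (mem_interior_iff_mem_nhds.1 hint)).and
      self_mem_nhdsWithin).exists
    have h := hstat _ ht
    rw [add_sub_cancel_left, map_smul, smul_eq_mul] at h
    exact nonneg_of_mul_nonneg_right h ht0
  have h0 : fderiv ℝ (G.objective τ i j) x (Pi.single i (Pi.single j 1)) = 0 := by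
    refine le_antisymm ?_ (hdir _)
    have := hdir (-Pi.single i (Pi.single j 1))
    rw [map_neg] at this
    linarith
  rw [hL, smul_apply, hu, smul_eq_mul] at h0
  have hne : -τ * ((Pi.single j 1 : Fin (n i) → ℝ) j / x i j +
      (∑ l, (Pi.single j 1 : Fin (n i) → ℝ) l) / (1 - ∑ l, x i l)) < 0 := by
    rw [Pi.single_eq_same, Finset.sum_pi_single']
    simp only [Finset.mem_univ, if_true, neg_mul]
    exact neg_neg_of_pos (by positivity)
  have := (mul_eq_zero.1 h0).resolve_right hne.ne
  linarith

theorem mem_stationary_of_gradT_eq_zero (G : SimplexGame N n) {τ : ℝ} {i : Fin N}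
    {j : Fin (n i)} {x : (i : Fin N) → Fin (n i) → ℝ} (hx : x ∈ hatDelta n τ)
    (h0 : G.gradT τ i j x = 0) : x ∈ G.stationary τ i j := by
  refine ⟨hx, fun y _ => ?_⟩
  obtain ⟨L, hL, -⟩ := G.exists_hasFDerivAt_objective τ i j (pos_of_mem_hatDelta hx i j).ne'
    (one_sub_sum_pos_of_mem_hatDelta hx i).ne'
  rw [hL, h0, mul_zero, zero_smul, zero_apply]

theorem mem_hatDelta_of_mem_commonStationary (G : SimplexGame N n) {τ : ℝ} (hτ : 0 < τ)
    {x : (i : Fin N) → Fin (n i) → ℝ} (hx : x ∈ G.commonStationary τ) : x ∈ hatDelta n τ := by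
  simp only [commonStationary, mem_iInter] at hx
  by_cases h : ∃ i, Nonempty (Fin (n i))
  · obtain ⟨i, ⟨j⟩⟩ := h
    exact (hx i j).1
  -- If no player has a free coordinate, the intersection is over an empty family and membership
  -- must be checked directly.
  · push Not at h
    intro i
    have := h i
    have h1 := exp_neg_div_le (a := τ ^ (3 / 2 : ℝ)) (m := maxDim n) (k := 0) (by positivity)
      (by simp)
    refine ⟨fun j => isEmptyElim j, ?_⟩
    rw [Finset.univ_eq_empty, Finset.sum_empty]
    norm_num at h1 ⊢
    exact h1

/-! ### Excluding the walls for small `τ = b⁻²` -/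

section SmallTemperature

variable (G : SimplexGame N n) {b : ℝ}

theorem neg_one_div_inv_sq_sq : -1 / ((b ^ 2)⁻¹) ^ 2 = -b ^ 4 := by
  rw [inv_pow, div_inv_eq_mul]
  ring

theorem neg_one_div_inv_sq_rpow (hb : 0 < b) : -1 / ((b ^ 2)⁻¹) ^ (3 / 2 : ℝ) = -b ^ 3 := by
  rw [inv_rpow (by positivity), ← rpow_natCast, ← rpow_mul hb.le,
    show ((2 : ℕ) : ℝ) * (3 / 2) = (3 : ℕ) by norm_num, rpow_natCast, div_inv_eq_mul]
  ring

theorem log_exp_div {a m : ℝ} (hm : 0 < m) : log (exp a / m) = a - log m := by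
  rw [log_div (exp_pos _).ne' hm.ne', log_exp]

theorem exp_neg_pow_div_lt {m : ℝ} (hm : 0 < m) (hb : 1 < b) {p q : ℕ} (h : p < q) :
    exp (-b ^ q) / m < exp (-b ^ p) / m := by
  have := pow_lt_pow_right₀ hb h
  gcongr

theorem mem_strictHatDelta_of_mem_commonStationary (hb : G.payoffBound + 3 < b)
    {x : (i : Fin N) → Fin (n i) → ℝ} (hx : x ∈ G.commonStationary (b ^ 2)⁻¹) :
    x ∈ strictHatDelta n (b ^ 2)⁻¹ := by
  have hC := G.payoffBound_nonneg
  have hb0 : 0 < b := by linarith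
  have hτ : 0 < (b ^ 2)⁻¹ := by positivity
  have hmem := G.mem_hatDelta_of_mem_commonStationary hτ hx
  simp only [commonStationary, mem_iInter] at hx
  have hbd := G.abs_payoff_le (mem_actionSetT_of_mem_hatDelta hmem)
  intro i
  have hi := hmem i
  have htest := fun j => G.gradT_mul_le_zero_of_mem_stationary hτ (hx i j)
  rw [neg_one_div_inv_sq_sq, neg_one_div_inv_sq_rpow hb0] at hi ⊢
  have hm : (0 : ℝ) < maxDim n + 1 := by positivity
  set m : ℝ := maxDim n + 1 with hmdef
  have hlt : exp (-b ^ 4) / m < exp (-b ^ 3) / m :=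
    exp_neg_pow_div_lt hm (by linarith) (by norm_num)
  have hε : 0 < exp (-b ^ 4) / m := by positivity
  have hxpos := pos_of_mem_hatDelta hmem i
  have hspos := one_sub_sum_pos_of_mem_hatDelta hmem i
  set s := 1 - ∑ l, x i l with hsdef
  have hs : exp (-b ^ 3) / m ≤ s := by linarith [hi.2]
  refine ⟨fun j => lt_of_le_of_ne (hi.1 j) fun heq => ?_, lt_of_le_of_ne hi.2 fun heq => ?_⟩
  · have h1 : 0 < 1 / x i j - 1 / s :=
      sub_pos.2 (one_div_lt_one_div_of_lt (hxpos j) (by linarith))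
    have h2 : 0 < G.gradT (b ^ 2)⁻¹ i j x := by
      have h3 : -b ^ 3 - log m ≤ log s := by
        rw [← log_exp_div hm]
        exact log_le_log (by positivity) hs
      -- The `log m` terms of the two walls cancel, leaving at least `b² - b`, which exceeds the
      -- payoff bound.
      have h4 : (b ^ 2)⁻¹ * (b ^ 4 - b ^ 3) ≤ (b ^ 2)⁻¹ * (log s - log (x i j)) := by
        rw [← heq, log_exp_div hm]
        exact mul_le_mul_of_nonneg_left (by linarith) hτ.le
      have h5 : (b ^ 2)⁻¹ * (b ^ 4 - b ^ 3) = b ^ 2 - b := by field_simp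
      have h6 := (abs_le.1 (hbd i j)).1
      rw [gradT, ← hsdef]
      nlinarith
    exact absurd (htest j) (not_le.2 (mul_pos h2 h1))
  · have hseq : s = exp (-b ^ 3) / m := by linarith
    have hlt1 : exp (-b ^ 3) < 1 :=
      (exp_lt_exp.2 (neg_neg_of_pos (pow_pos hb0 3))).trans_eq exp_zero
    have hni : (n i : ℝ) + 1 ≤ m := by
      have : (n i : ℝ) ≤ maxDim n := by exact_mod_cast le_maxDim n i
      linarith
    have hm1 : 1 / m ≤ 1 / ((n i : ℝ) + 1) := one_div_le_one_div_of_le (by positivity) hni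
    have hs1 : s < 1 / m := by
      rw [hseq]
      gcongr
    -- Otherwise all `n i + 1` coordinates, including `s`, are below `1 / m ≤ 1 / (n i + 1)` and
    -- cannot sum to one.
    obtain ⟨j, hj⟩ : ∃ j, 1 / m ≤ x i j := by
      by_contra! hall
      have h1 : ∑ j, x i j ≤ ∑ _j : Fin (n i), 1 / ((n i : ℝ) + 1) :=
        Finset.sum_le_sum fun j _ => (hall j).le.trans hm1
      rw [Finset.sum_const, Finset.card_univ, Fintype.card_fin, nsmul_eq_mul] at h1
      have h2 : (n i : ℝ) * (1 / ((n i : ℝ) + 1)) = 1 - 1 / ((n i : ℝ) + 1) := by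
        field_simp
        ring
      linarith
    have h1 : 1 / x i j - 1 / s < 0 :=
      sub_neg.2 (one_div_lt_one_div_of_lt hspos (by linarith))
    have h2 : G.gradT (b ^ 2)⁻¹ i j x < 0 := by
      have h3 : -log m ≤ log (x i j) := by
        rw [← log_inv, ← one_div]
        exact log_le_log (by positivity) hj
      have h4 : (b ^ 2)⁻¹ * (log s - log (x i j)) ≤ (b ^ 2)⁻¹ * (-b ^ 3) := by
        rw [hseq, log_exp_div hm]
        exact mul_le_mul_of_nonneg_left (by linarith) hτ.le
      have h5 : (b ^ 2)⁻¹ * (-b ^ 3) = -b := by field_simp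
      have h6 := (abs_le.1 (hbd i j)).2
      rw [gradT, ← hsdef]
      linarith
    exact absurd (htest j) (not_le.2 (mul_pos_of_neg_of_neg h2 h1))

/-- The softmax bounds with `c = C b²` beat the walls, since `2 C b² < b ^ 4` and `C b² < b ^ 3`,
where `C` is `payoffBound`. -/
theorem mem_strictHatDelta_of_mem_nashT (hb : G.payoffBound + 3 < b)
    {x : (i : Fin N) → Fin (n i) → ℝ} (hx : x ∈ G.nashT (b ^ 2)⁻¹) :
    x ∈ strictHatDelta n (b ^ 2)⁻¹ := by
  have hC := G.payoffBound_nonneg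
  have hb0 : 0 < b := by linarith
  have hτ : 0 < (b ^ 2)⁻¹ := by positivity
  have hbd := G.abs_payoff_le hx.1
  rw [G.mem_nashT_iff hτ] at hx
  intro i
  rw [neg_one_div_inv_sq_sq, neg_one_div_inv_sq_rpow hb0]
  have hni : (n i : ℝ) ≤ maxDim n := by exact_mod_cast le_maxDim n i
  have hc : 0 ≤ G.payoffBound * b ^ 2 := by positivity
  have hh : ∀ j, |G.payoff i j x / (b ^ 2)⁻¹| ≤ G.payoffBound * b ^ 2 := fun j => by
    rw [div_inv_eq_mul, abs_mul, abs_of_pos (a := b ^ 2) (by positivity)]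
    exact mul_le_mul_of_nonneg_right (hbd i j) (by positivity)
  have hb2 : 0 < b ^ 2 := by positivity
  rw [hx i]
  constructor
  · intro j
    refine lt_of_lt_of_le ?_ (le_softmaxT hc hh j)
    have h0 : 2 * G.payoffBound < b ^ 2 := by nlinarith
    have h1 : 2 * (G.payoffBound * b ^ 2) < b ^ 4 := by
      linarith [mul_lt_mul_of_pos_right h0 hb2]
    have : exp (-b ^ 4) < exp (-(2 * (G.payoffBound * b ^ 2))) := exp_lt_exp.2 (by linarith)
    gcongr
  · have h1 : G.payoffBound * b ^ 2 < b ^ 3 := by nlinarith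
    have h2 : exp (-b ^ 3) / (maxDim n + 1 : ℝ) < exp (-(G.payoffBound * b ^ 2)) / (n i + 1) := by
      have : exp (-b ^ 3) < exp (-(G.payoffBound * b ^ 2)) := exp_lt_exp.2 (by linarith)
      gcongr
    have h3 := le_one_sub_sum_softmaxT hc hh
    linarith

theorem commonStationary_eq_nashT (hb : G.payoffBound + 3 < b) :
    G.commonStationary (b ^ 2)⁻¹ = G.nashT (b ^ 2)⁻¹ := by
  have hC := G.payoffBound_nonneg
  have hb0 : 0 < b := by linarith
  have hτ : 0 < (b ^ 2)⁻¹ := by positivity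
  ext x
  have hiff : x ∈ hatDelta n (b ^ 2)⁻¹ →
      (x ∈ G.nashT (b ^ 2)⁻¹ ↔ ∀ i j, G.gradT (b ^ 2)⁻¹ i j x = 0) := fun hx =>
    G.mem_nashT_iff_gradT_eq_zero hτ (pos_of_mem_hatDelta hx) (one_sub_sum_pos_of_mem_hatDelta hx)
  constructor
  · intro hx
    have hint := strictHatDelta_subset_interior _ _
      (G.mem_strictHatDelta_of_mem_commonStationary hb hx)
    simp only [commonStationary, mem_iInter] at hx
    exact (hiff (interior_subset hint)).2 fun i j =>
      G.gradT_eq_zero_of_mem_stationary_of_mem_interior hτ (hx i j) hint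
  · intro hx
    have hmem := interior_subset (strictHatDelta_subset_interior _ _
      (G.mem_strictHatDelta_of_mem_nashT hb hx))
    simp only [commonStationary, mem_iInter]
    exact fun i j => G.mem_stationary_of_gradT_eq_zero hmem ((hiff hmem).1 hx i j)

end SmallTemperature

end SimplexGame

theorem mainTheorem2 {N : ℕ} {n : Fin N → ℕ} (G : SimplexGame N n) :
    ∃ τ₀ : ℝ, 0 < τ₀ ∧ ∀ τ : ℝ, 0 < τ → τ < τ₀ →
      (G.commonStationary τ).Nonempty ∧
      G.commonStationary τ = G.nashT τ ∧
      ∀ x ∈ frontier (SimplexGame.hatDelta n τ), x ∉ G.commonStationary τ := by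
  have hC := G.payoffBound_nonneg
  -- This threshold is the condition `b > payoffBound + 3` rewritten through `τ = b⁻²`.
  refine ⟨((G.payoffBound + 3) ^ 2)⁻¹, by positivity, fun τ hτ hlt => ?_⟩
  obtain ⟨b, hb, rfl⟩ : ∃ b, G.payoffBound + 3 < b ∧ τ = (b ^ 2)⁻¹ := by
    refine ⟨√τ⁻¹, lt_sqrt_of_sq_lt ((lt_inv_comm₀ hτ (by positivity)).1 hlt), ?_⟩
    rw [sq_sqrt (by positivity), inv_inv]
  have heq := G.commonStationary_eq_nashT hb
  refine ⟨heq ▸ G.nashT_nonempty hτ, heq, fun x hfr hx => hfr.2 ?_⟩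
  exact SimplexGame.strictHatDelta_subset_interior _ _
    (G.mem_strictHatDelta_of_mem_commonStationary hb hx)
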